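/- **Optimality of the load-factor heuristic under the same distribution family.** Consider finitely many $GI/GI/\infty$ queues $Q_k$. At $Q_k$ the inter-arrival times $X_k(1),X_k(2),\dots$ are i.i.d. and nonnegative with a density and finite mean, the service times $T_k(1),T_k(2),\dots$ are i.i.d. and nonnegative with a density $f_{T_k}$ and finite mean, and the two sequences are independent. Let $\rho_k=\mathbb E[T_k(1)]/\mathbb E[X_k(1)]$ be the load factor. A busy period starts with an arrival to the empty queue and lasts until the queue is next empty; let $B_k\in\{1,2,\dots,\infty\}$ be the number of arrivals in it. Suppose $B_k=b$, with arrival times $Y(1)\le\dots\le Y(b)$ and ordered departure times $D(1)\le\dots\le D(b)$. The true matching $\pi^t$ is the permutation of $\{1,\dots,b\}$ such that $D(\pi^t(i))$ is the departure time of the $i$-th arrival. FIFO matching outputs the identity permutation. Random matching outputs, given $Y$ and $D$, a uniformly chosen permutation among the valid ones, i.e. those $\pi$ with $\prod_{i=1}^b f_{T_k}(D(\pi(i))-Y(i))>0$. For $\gamma\in\{\mathrm{FIFO},\mathrm{rand}\}$ the tracking accuracy is $$P^{\gamma}(k)=\sum_{b=1}^{\infty}\mathbb P[\pi^{\gamma}=\pi^{t},\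 B_k=b].$$ Assume that all inter-arrival laws are linear rescalings of one law (the law of $X_k(1)$ is that of $a_kX$ with $a_k>0$), and that all service laws are linear rescalings of one law (the law of $T_k(1)$ is that of $c_kT$ with $c_k>0$). For the claims on random matching assume also that, for each $k$, the set $\{f_{T_k}>0\}$ is, up to a Lebesgue-null set, an interval (bounded or unbounded). Then for $\gamma=\mathrm{FIFO}$ and for $\gamma=\mathrm{rand}$: 1. for all $k,m$: $\rho_k\ge\rho_m$ implies $P^\gamma(k)\le P^\gamma(m)$; 2. for every budget $E\in\{0,1,2,\dots\}$ the load-factor heuristic, which instruments queues in decreasing order of load factor (ties broken arbitrarily) until $E$ queues, or all queues if there are at most $E$, are instrumented, is optimal: its indicator vector $z$ maximises $\sum_k\{z_k+(1-z_k)P^\gamma(k)\}$ subject to $z_k\in\{0,1\}$ and $\sum_k z_k\le E$. -/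

import Mathlib

open MeasureTheory
open scoped ENNReal

noncomputable section

/-- `f` is a probability density function of a nonnegative continuous random variable with
finite mean. -/
structure IsLifetimePdf (f : ℝ → ℝ) : Prop where
  measurable : Measurable f
  nonneg : ∀ t, 0 ≤ f t
  eq_zero_of_neg : ∀ t, t < 0 → f t = 0
  lintegral_eq_one : ∫⁻ t, ENNReal.ofReal (f t) = 1
  integrable_mean : Integrable (fun t => t * f t)

/-- The law on `ℝ` with density `f`. -/
def lawOfPdf (f : ℝ → ℝ) : Measure ℝ :=
  (volume : Measure ℝ).withDensity (fun t => ENNReal.ofReal (f t))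

/-- A `GI/GI/∞` queue, given by the density of its i.i.d. inter-arrival times and the density of
its i.i.d. service times. -/
structure InfServerQueue where
  arrivalPdf : ℝ → ℝ
  servicePdf : ℝ → ℝ
  isPdf_arrival : IsLifetimePdf arrivalPdf
  isPdf_service : IsLifetimePdf servicePdf

namespace InfServerQueue

/-- Law of one inter-arrival time. -/
def arrivalLaw (Q : InfServerQueue) : Measure ℝ := lawOfPdf Q.arrivalPdf

/-- Law of one service time. -/
def serviceLaw (Q : InfServerQueue) : Measure ℝ := lawOfPdf Q.servicePdf

instance (Q : InfServerQueue) : IsProbabilityMeasure Q.arrivalLaw :=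
  ⟨by simpa [arrivalLaw, lawOfPdf] using Q.isPdf_arrival.lintegral_eq_one⟩

instance (Q : InfServerQueue) : IsProbabilityMeasure Q.serviceLaw :=
  ⟨by simpa [serviceLaw, lawOfPdf] using Q.isPdf_service.lintegral_eq_one⟩

/-- Arrival rate `λ = 1 / 𝔼[X]`. -/
def arrivalRate (Q : InfServerQueue) : ℝ := 1 / ∫ x, x ∂Q.arrivalLaw

/-- Service rate `μ = 1 / 𝔼[T]`. -/
def serviceRate (Q : InfServerQueue) : ℝ := 1 / ∫ t, t ∂Q.serviceLaw

/-- Load factor `ρ = λ / μ`. -/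
def loadFactor (Q : InfServerQueue) : ℝ := Q.arrivalRate / Q.serviceRate

/-- Law of the sequence `i ↦ (X(i), T(i))`: the pairs are independent and identically distributed,
and `X(i)` is independent of `T(i)`. Transactions are numbered from `0`; transaction `0` opens the
busy period and `X(i)` is the time between the arrivals of transactions `i` and `i + 1`. -/
def law (Q : InfServerQueue) : Measure (ℕ → ℝ × ℝ) :=
  Measure.infinitePi (fun _ : ℕ => Q.arrivalLaw.prod Q.serviceLaw)

end InfServerQueue

/-- Arrival time of transaction `i`, measured from the start of the busy period. -/
def arrivalTime (ω : ℕ → ℝ × ℝ) (i : ℕ) : ℝ := ∑ j ∈ Finset.range i, (ω j).1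

/-- Departure time of transaction `i`: with infinitely many servers, service starts on arrival. -/
def departureTime (ω : ℕ → ℝ × ℝ) (i : ℕ) : ℝ := arrivalTime ω i + (ω i).2

/-- The busy period consists of exactly `b` transactions: `b ≥ 1` is the least number such that
the first `b` transactions have all left before the next arrival. -/
def HasBusyPeriodSize (ω : ℕ → ℝ × ℝ) (b : ℕ) : Prop :=
  IsLeast {n : ℕ | 1 ≤ n ∧ ∀ i < n, departureTime ω i < arrivalTime ω n} b

/-- The arrival timestamps `Y` of the first `b` transactions. -/
def arrivalStamps (ω : ℕ → ℝ × ℝ) (b : ℕ) : Fin b → ℝ := fun i => arrivalTime ω i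

/-- The true matching `π^t`: the rank, among the first `b` departures in increasing order, of the
departure of each transaction. -/
def trueMatching (ω : ℕ → ℝ × ℝ) (b : ℕ) : Equiv.Perm (Fin b) :=
  (Tuple.sort (fun i : Fin b => departureTime ω i))⁻¹

/-- The departure timestamps `D` of the first `b` transactions, in increasing order. -/
def departureStamps (ω : ℕ → ℝ × ℝ) (b : ℕ) : Fin b → ℝ :=
  fun j => departureTime ω (Tuple.sort (fun i : Fin b => departureTime ω i) j)

/-- A (possibly randomised) matching policy sees the arrival timestamps and the ordered departure
timestamps of a busy period, and draws a matching from the returned distribution. -/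
abbrev MatchingPolicy : Type :=
  (b : ℕ) → (Fin b → ℝ) → (Fin b → ℝ) → PMF (Equiv.Perm (Fin b))

/-- FIFO: always the identity matching. -/
def fifoPolicy : MatchingPolicy := fun _ _ _ => PMF.pure 1

open Classical in
/-- The matchings `π` with `∏ i, f (D (π i) - Y i) > 0`, where `f` is the service density. -/
def validMatchings (f : ℝ → ℝ) {b : ℕ} (y d : Fin b → ℝ) : Finset (Equiv.Perm (Fin b)) :=
  Finset.univ.filter (fun π => 0 < ∏ i, f (d (π i) - y i))

open Classical in
/-- Random matching: uniform over the valid matchings. (The true matching is almost surely valid,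
so the second branch has probability zero.) -/
def randomPolicy (f : ℝ → ℝ) : MatchingPolicy := fun _ y d =>
  if h : (validMatchings f y d).Nonempty then PMF.uniformOfFinset (validMatchings f y d) h
  else PMF.pure 1

namespace InfServerQueue

/-- Tracking accuracy `∑_b ℙ[π^γ = π^t, B = b]`: the probability that the policy matches all the
arrivals and departures of a busy period correctly. -/
def trackingAccuracy (Q : InfServerQueue) (γ : MatchingPolicy) : ℝ :=
  (∑' b : ℕ, ∫⁻ ω in {ω | HasBusyPeriodSize ω b},
    γ b (arrivalStamps ω b) (departureStamps ω b) (trueMatching ω b) ∂Q.law).toReal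

/-- `P^FIFO`. -/
def fifoAccuracy (Q : InfServerQueue) : ℝ := Q.trackingAccuracy fifoPolicy

/-- `P^rand`. -/
def randomAccuracy (Q : InfServerQueue) : ℝ := Q.trackingAccuracy (randomPolicy Q.servicePdf)

end InfServerQueue

/-- `μ` is the law of `c * Z` for some `c > 0`, where `Z` has law `ν`. -/
def IsLinearRescaling (μ ν : Measure ℝ) : Prop :=
  ∃ c : ℝ, 0 < c ∧ μ = ν.map (fun x => c * x)

/-- Up to a null set, `f` is positive exactly on an interval (bounded or not). -/
def HasIntervalSupport (f : ℝ → ℝ) : Prop :=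
  ∃ I : Set ℝ, I.OrdConnected ∧ {t | 0 < f t} =ᵐ[volume] I

section Allocation

variable {ι : Type*} [Fintype ι]

/-- `z` instruments at most `E` queues: `z k ∈ {0, 1}` and `∑ k, z k ≤ E`. -/
def IsFeasibleAllocation (E : ℕ) (z : ι → ℝ) : Prop :=
  (∀ k, z k = 0 ∨ z k = 1) ∧ ∑ k, z k ≤ E

/-- Overall tracking accuracy after instrumentation. -/
def overallAccuracy (P z : ι → ℝ) : ℝ := ∑ k, (z k + (1 - z k) * P k)

/-- `z` maximises the overall tracking accuracy under the budget `E`. -/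
def IsOptimalAllocation (P : ι → ℝ) (E : ℕ) (z : ι → ℝ) : Prop :=
  IsFeasibleAllocation E z ∧
    ∀ z' : ι → ℝ, IsFeasibleAllocation E z' → overallAccuracy P z' ≤ overallAccuracy P z

/-- `z` is an output of the load-factor heuristic: the queues are listed in decreasing order of
load factor (ties broken arbitrarily) and the first `E` of them are instrumented (all of them, if
there are at most `E`). -/
def IsLoadFactorAllocation (ρ : ι → ℝ) (E : ℕ) (z : ι → ℝ) : Prop :=
  ∃ e : Fin (Fintype.card ι) ≃ ι, Antitone (fun i => ρ (e i)) ∧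
    ∀ i, z (e i) = if (i : ℕ) < E then 1 else 0

end Allocation

end

/-! The accuracy comparison is a pathwise coupling. Within common scale families, a path of the more
loaded queue becomes a path of the less loaded one when inter-arrival times are multiplied by `a`
and service times by `c`; the load factor is multiplied by `c / a`, so `c ≤ a`. Up to the time unit,
services only shrink relative to arrivals. A finite busy period then stays finite and does not gain
transactions (`HasBusyPeriodSize.exists_scalePath`), so it suffices that the conditional probability
of success does not drop along the coupling (`IsWeightOf.trackingAccuracy_le`).

For FIFO, departures that occur in arrival order still do after rescaling (`fifoAccuracy_le`). For
random matching the success probability is the inverse of the number of valid matchings, and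
interval support injects the valid matchings of the rescaled path into those of the original
(`card_rearrangements_scalePath_le`).

Optimality of the heuristic is then an exchange argument: instrumenting queue `k` gains `1 - P k`,
which increases with the load factor. -/

/-! ### Optimal allocation under a budget -/

/-- Instrumenting the queues with the smallest accuracies first is optimal. -/
theorem IsLoadFactorAllocation.isOptimalAllocation {ι : Type*} [Fintype ι] {ρ P z : ι → ℝ} {E : ℕ}
    (hz : IsLoadFactorAllocation ρ E z) (hP : ∀ k, P k ≤ 1)
    (hanti : ∀ k m, ρ m ≤ ρ k → P k ≤ P m) : IsOptimalAllocation P E z := by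
  obtain ⟨e, he, hze⟩ := hz
  have hz01 : ∀ k, z k = 0 ∨ z k = 1 := by
    intro k
    have h := hze (e.symm k)
    rw [Equiv.apply_symm_apply] at h
    rw [h]
    split_ifs <;> simp
  have hsum : ∑ k, z k = (min (Fintype.card ι) E : ℕ) := by
    rw [← e.sum_comp]
    simp only [hze, Finset.sum_boole]
    congr 1
    rcases le_total (Fintype.card ι) E with h | h
    · rw [Finset.filter_true_of_mem (fun i _ => i.2.trans_le h), min_eq_left h]
      simp
    · rw [min_eq_right h, Fin.card_filter_val_lt, min_eq_right h]
  refine ⟨⟨hz01, by rw [hsum]; exact_mod_cast min_le_right _ _⟩, fun z' hz' => ?_⟩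
  have key : 0 ≤ ∑ k, (z k - z' k) * (1 - P k) := by
    rcases le_or_gt (Fintype.card ι) E with h | h
    · refine Finset.sum_nonneg fun k _ => mul_nonneg ?_ (sub_nonneg.2 (hP k))
      have h1 := hze (e.symm k)
      rw [Equiv.apply_symm_apply, if_pos ((e.symm k).2.trans_le h)] at h1
      rcases hz'.1 k with h2 | h2 <;> rw [h1, h2] <;> norm_num
    · rw [min_eq_right h.le] at hsum
      -- The first uninstrumented queue serves as threshold. Measured against `1 - p`, gains are
      -- nonnegative where `z = 1` and nonpositive where `z = 0`, matching the sign of `z - z'`. The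
      -- correction term is nonnegative because `z` spends the whole budget.
      set p := P (e ⟨E, h⟩) with hp
      have h1 : ∀ k, 0 ≤ (z k - z' k) * ((1 - P k) - (1 - p)) := by
        intro k
        have hk := hze (e.symm k)
        rw [Equiv.apply_symm_apply] at hk
        split_ifs at hk with hlt
        · refine mul_nonneg ?_ ?_
          · rcases hz'.1 k with h2 | h2 <;> rw [hk, h2] <;> norm_num
          · have := hanti k (e ⟨E, h⟩) (by
              simpa using he (show e.symm k ≤ ⟨E, h⟩ from hlt.le))
            linarith
        · refine mul_nonneg_of_nonpos_of_nonpos ?_ ?_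
          · rcases hz'.1 k with h2 | h2 <;> rw [hk, h2] <;> norm_num
          · have := hanti (e ⟨E, h⟩) k (by
              simpa using he (show (⟨E, h⟩ : Fin _) ≤ e.symm k from not_lt.1 hlt))
            linarith
      have h2 : ∑ k, (z k - z' k) * (1 - P k)
          = ∑ k, (z k - z' k) * ((1 - P k) - (1 - p)) + (∑ k, z k - ∑ k, z' k) * (1 - p) := by
        rw [← Finset.sum_sub_distrib, Finset.sum_mul, ← Finset.sum_add_distrib]
        exact Finset.sum_congr rfl fun k _ => by ring
      rw [h2]
      refine add_nonneg (Finset.sum_nonneg fun k _ => h1 k) (mul_nonneg ?_ (sub_nonneg.2 (hP _)))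
      rw [hsum]
      exact sub_nonneg.2 hz'.2
  have h3 : overallAccuracy P z - overallAccuracy P z' = ∑ k, (z k - z' k) * (1 - P k) := by
    rw [overallAccuracy, overallAccuracy, ← Finset.sum_sub_distrib]
    exact Finset.sum_congr rfl fun k _ => by ring
  linarith

/-! ### Tracking accuracy as the integral of a weight over paths -/

theorem HasBusyPeriodSize.unique {ω : ℕ → ℝ × ℝ} {b b' : ℕ} (h : HasBusyPeriodSize ω b)
    (h' : HasBusyPeriodSize ω b') : b = b' := IsLeast.unique h h'

@[fun_prop]
theorem measurable_arrivalTime (i : ℕ) : Measurable fun ω => arrivalTime ω i := by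
  unfold arrivalTime; fun_prop

@[fun_prop]
theorem measurable_departureTime (i : ℕ) : Measurable fun ω => departureTime ω i := by
  unfold departureTime; fun_prop

theorem measurableSet_hasBusyPeriodSize (b : ℕ) :
    MeasurableSet {ω : ℕ → ℝ × ℝ | HasBusyPeriodSize ω b} := by
  have hC : ∀ n : ℕ, MeasurableSet {ω : ℕ → ℝ × ℝ |
      1 ≤ n ∧ ∀ i < n, departureTime ω i < arrivalTime ω n} := fun n => by
    have : {ω : ℕ → ℝ × ℝ | 1 ≤ n ∧ ∀ i < n, departureTime ω i < arrivalTime ω n} =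
        {_ω | 1 ≤ n} ∩ ⋂ i, ⋂ (_ : i < n), {ω | departureTime ω i < arrivalTime ω n} := by
      ext ω; simp
    rw [this]
    exact (MeasurableSet.const _).inter <|
      .iInter fun i => .iInter fun _ => measurableSet_lt (by fun_prop) (by fun_prop)
  have : {ω : ℕ → ℝ × ℝ | HasBusyPeriodSize ω b} =
      {ω | 1 ≤ b ∧ ∀ i < b, departureTime ω i < arrivalTime ω b} ∩
        ⋂ n, ({ω | 1 ≤ n ∧ ∀ i < n, departureTime ω i < arrivalTime ω n}ᶜ ∪ {_ω | b ≤ n}) := by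
    ext ω
    simp only [HasBusyPeriodSize, IsLeast, mem_lowerBounds, Set.mem_ofPred_eq, Set.mem_inter_iff,
      Set.mem_iInter, Set.mem_union, Set.mem_compl_iff, imp_iff_not_or]
  rw [this]
  exact (hC b).inter (.iInter fun n => (hC n).compl.union (.const _))

/-- The weight of the busy period of the path `ω`, and `0` if it is infinite. -/
noncomputable def busyPeriodWeight (w : ℕ → (ℕ → ℝ × ℝ) → ℝ≥0∞) (ω : ℕ → ℝ × ℝ) : ℝ≥0∞ :=
  ∑' b, {ω | HasBusyPeriodSize ω b}.indicator (w b) ω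

theorem busyPeriodWeight_eq {w : ℕ → (ℕ → ℝ × ℝ) → ℝ≥0∞} {ω : ℕ → ℝ × ℝ} {b : ℕ}
    (h : HasBusyPeriodSize ω b) : busyPeriodWeight w ω = w b ω := by
  rw [busyPeriodWeight, tsum_eq_single b fun b' hb' => ?_]
  · exact Set.indicator_of_mem (s := {ω | HasBusyPeriodSize ω b}) h _
  · exact Set.indicator_of_notMem (s := {ω | HasBusyPeriodSize ω b'})
      (fun h' => hb' (HasBusyPeriodSize.unique h' h)) _

theorem busyPeriodWeight_eq_zero {w : ℕ → (ℕ → ℝ × ℝ) → ℝ≥0∞} {ω : ℕ → ℝ × ℝ}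
    (h : ∀ b, ¬ HasBusyPeriodSize ω b) : busyPeriodWeight w ω = 0 :=
  ENNReal.tsum_eq_zero.2 fun b =>
    Set.indicator_of_notMem (s := {ω | HasBusyPeriodSize ω b}) (h b) _

theorem measurable_busyPeriodWeight {w : ℕ → (ℕ → ℝ × ℝ) → ℝ≥0∞} (hw : ∀ b, Measurable (w b)) :
    Measurable (busyPeriodWeight w) :=
  Measurable.tsum fun b => (hw b).indicator (measurableSet_hasBusyPeriodSize b)

namespace InfServerQueue

instance (Q : InfServerQueue) : IsProbabilityMeasure Q.law := by
  unfold law; infer_instance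

/-- `w b` is a measurable version of the probability with which `γ` is correct on a busy period
of size `b`. -/
structure IsWeightOf (Q : InfServerQueue) (γ : MatchingPolicy)
    (w : ℕ → (ℕ → ℝ × ℝ) → ℝ≥0∞) : Prop where
  measurable : ∀ b, Measurable (w b)
  ae_eq : ∀ᵐ ω ∂Q.law, ∀ b,
    γ b (arrivalStamps ω b) (departureStamps ω b) (trueMatching ω b) = w b ω

variable {Q Q' : InfServerQueue} {γ γ' : MatchingPolicy} {w w' : ℕ → (ℕ → ℝ × ℝ) → ℝ≥0∞}

theorem IsWeightOf.trackingAccuracy_eq (h : Q.IsWeightOf γ w) :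
    Q.trackingAccuracy γ = (∫⁻ ω, busyPeriodWeight w ω ∂Q.law).toReal := by
  unfold trackingAccuracy busyPeriodWeight
  rw [lintegral_tsum fun b =>
    ((h.measurable b).indicator (measurableSet_hasBusyPeriodSize b)).aemeasurable]
  congr 2
  funext b
  rw [lintegral_indicator (measurableSet_hasBusyPeriodSize b)]
  refine lintegral_congr_ae (ae_restrict_of_ae ?_)
  filter_upwards [h.ae_eq] with ω hω using hω b

theorem IsWeightOf.lintegral_le_one (h : Q.IsWeightOf γ w) :
    ∫⁻ ω, busyPeriodWeight w ω ∂Q.law ≤ 1 := by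
  calc ∫⁻ ω, busyPeriodWeight w ω ∂Q.law ≤ ∫⁻ _, 1 ∂Q.law := by
        refine lintegral_mono_ae ?_
        filter_upwards [h.ae_eq] with ω hω
        by_cases hb : ∃ b, HasBusyPeriodSize ω b
        · obtain ⟨b, hb⟩ := hb
          rw [busyPeriodWeight_eq hb, ← hω b]
          exact PMF.coe_le_one _ _
        · rw [busyPeriodWeight_eq_zero (not_exists.1 hb)]
          exact zero_le
    _ = 1 := by simp

theorem IsWeightOf.trackingAccuracy_le_one (h : Q.IsWeightOf γ w) :
    Q.trackingAccuracy γ ≤ 1 := by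
  rw [h.trackingAccuracy_eq]
  exact ENNReal.toReal_le_of_le_ofReal zero_le_one (by simpa using h.lintegral_le_one)

/-- Comparison of the accuracies at two queues whose paths are coupled by `Φ`. -/
theorem IsWeightOf.trackingAccuracy_le (h : Q.IsWeightOf γ w) (h' : Q'.IsWeightOf γ' w')
    {Φ : (ℕ → ℝ × ℝ) → (ℕ → ℝ × ℝ)} (hΦ : Measurable Φ) (hlaw : Q'.law = Q.law.map Φ)
    (hle : ∀ᵐ ω ∂Q.law, ∀ b, HasBusyPeriodSize ω b →
      ∃ b', HasBusyPeriodSize (Φ ω) b' ∧ w b ω ≤ w' b' (Φ ω)) :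
    Q.trackingAccuracy γ ≤ Q'.trackingAccuracy γ' := by
  rw [h.trackingAccuracy_eq, h'.trackingAccuracy_eq]
  refine ENNReal.toReal_mono (h'.lintegral_le_one.trans_lt ENNReal.one_lt_top).ne ?_
  rw [hlaw, lintegral_map (measurable_busyPeriodWeight h'.measurable) hΦ]
  refine lintegral_mono_ae ?_
  filter_upwards [hle] with ω hω
  by_cases hb : ∃ b, HasBusyPeriodSize ω b
  · obtain ⟨b, hb⟩ := hb
    obtain ⟨b', hb', hw⟩ := hω b hb
    rwa [busyPeriodWeight_eq hb, busyPeriodWeight_eq hb']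
  · rw [busyPeriodWeight_eq_zero (not_exists.1 hb)]
    exact zero_le

end InfServerQueue

/-! ### Rescaling of paths, laws and load factors -/

/-- The path in which inter-arrival times are multiplied by `a` and service times by `c`. -/
def scalePath (a c : ℝ) (ω : ℕ → ℝ × ℝ) : ℕ → ℝ × ℝ := fun i => (a * (ω i).1, c * (ω i).2)

theorem measurable_scalePath (a c : ℝ) : Measurable (scalePath a c) := by
  unfold scalePath; fun_prop

theorem arrivalTime_scalePath (a c : ℝ) (ω : ℕ → ℝ × ℝ) (i : ℕ) :
    arrivalTime (scalePath a c ω) i = a * arrivalTime ω i := by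
  simp [arrivalTime, scalePath, Finset.mul_sum]

theorem departureTime_scalePath (a c : ℝ) (ω : ℕ → ℝ × ℝ) (i : ℕ) :
    departureTime (scalePath a c ω) i = a * arrivalTime ω i + c * (ω i).2 := by
  rw [departureTime, arrivalTime_scalePath]; rfl

/-- Replacing `c` by `a` only delays departures, and uniform scaling by `a` preserves their order
relative to arrivals. So the rescaled system is still empty just before arrival `b`, but it may have
emptied earlier. -/
theorem HasBusyPeriodSize.exists_scalePath {a c : ℝ} (ha : 0 < a) (hca : c ≤ a)
    {ω : ℕ → ℝ × ℝ} (hω : ∀ i, 0 ≤ (ω i).2) {b : ℕ} (hb : HasBusyPeriodSize ω b) :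
    ∃ b' ≤ b, HasBusyPeriodSize (scalePath a c ω) b' := by
  classical
  have hscale : ∀ i < b,
      departureTime (scalePath a c ω) i < arrivalTime (scalePath a c ω) b := fun i hi => by
    rw [departureTime_scalePath, arrivalTime_scalePath]
    have h1 := mul_lt_mul_of_pos_left (hb.1.2 i hi) ha
    rw [departureTime, mul_add] at h1
    exact (add_le_add_right (mul_le_mul_of_nonneg_right hca (hω i)) _).trans_lt h1
  have h : ∃ n, 1 ≤ n ∧ ∀ i < n,
      departureTime (scalePath a c ω) i < arrivalTime (scalePath a c ω) n := ⟨b, hb.1.1, hscale⟩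
  exact ⟨Nat.find h, Nat.find_min' h ⟨hb.1.1, hscale⟩, Nat.find_spec h,
    fun n hn => Nat.find_min' h hn⟩

theorem IsLinearRescaling.exists_map_eq {μ μ' ν : Measure ℝ} (h : IsLinearRescaling μ ν)
    (h' : IsLinearRescaling μ' ν) : IsLinearRescaling μ' μ := by
  obtain ⟨c, hc, rfl⟩ := h
  obtain ⟨c', hc', rfl⟩ := h'
  refine ⟨c' / c, div_pos hc' hc, ?_⟩
  rw [Measure.map_map (by fun_prop) (by fun_prop)]
  congr 1
  funext x
  simp only [Function.comp_apply]
  field_simp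

theorem IsLifetimePdf.ae_pos_lawOfPdf {f : ℝ → ℝ} (hf : IsLifetimePdf f) :
    ∀ᵐ t ∂lawOfPdf f, 0 < f t := by
  rw [lawOfPdf, ae_withDensity_iff hf.measurable.ennreal_ofReal]
  exact ae_of_all _ fun t ht => by simpa using ht

theorem IsLifetimePdf.ae_nonneg_lawOfPdf {f : ℝ → ℝ} (hf : IsLifetimePdf f) :
    ∀ᵐ t ∂lawOfPdf f, 0 ≤ t := by
  filter_upwards [hf.ae_pos_lawOfPdf] with t ht
  by_contra h
  exact ht.ne' (hf.eq_zero_of_neg t (not_le.1 h))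

/-- A law with a density has no atom at `0`, so a nonnegative variable with this law cannot vanish
almost surely. -/
theorem IsLifetimePdf.integral_lawOfPdf_pos {f : ℝ → ℝ} (hf : IsLifetimePdf f) :
    0 < ∫ t, t ∂lawOfPdf f := by
  have hint : Integrable (fun t : ℝ => t) (lawOfPdf f) := by
    rw [lawOfPdf, integrable_withDensity_iff hf.measurable.ennreal_ofReal (by simp)]
    simpa [ENNReal.toReal_ofReal (hf.nonneg _)] using hf.integrable_mean
  rw [integral_pos_iff_support_of_nonneg_ae hf.ae_nonneg_lawOfPdf hint]
  have h0 : lawOfPdf f (Function.support fun t : ℝ => t)ᶜ = 0 := by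
    have : (Function.support fun t : ℝ => t)ᶜ = {0} := by ext; simp
    rw [this]
    exact withDensity_absolutelyContinuous _ _ (by simp)
  rw [pos_iff_ne_zero]
  intro h1
  have h2 : lawOfPdf f Set.univ = 0 := by
    rw [← Set.union_compl_self (Function.support fun t : ℝ => t)]
    exact measure_union_null h1 h0
  rw [lawOfPdf, withDensity_apply _ MeasurableSet.univ, Measure.restrict_univ,
    hf.lintegral_eq_one] at h2
  exact one_ne_zero h2

namespace InfServerQueue

variable {Q Q' : InfServerQueue}

theorem ae_law_coord (Q : InfServerQueue) {p : ℝ × ℝ → Prop}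
    (hp : ∀ᵐ x ∂Q.arrivalLaw.prod Q.serviceLaw, p x) : ∀ᵐ ω ∂Q.law, ∀ i, p (ω i) :=
  ae_all_iff.2 fun i =>
    (measurePreserving_eval_infinitePi (fun _ : ℕ => Q.arrivalLaw.prod Q.serviceLaw)
      i).quasiMeasurePreserving.ae hp

theorem ae_service (Q : InfServerQueue) {p : ℝ → Prop} (hp : ∀ᵐ t ∂Q.serviceLaw, p t) :
    ∀ᵐ ω ∂Q.law, ∀ i, p (ω i).2 :=
  Q.ae_law_coord (Measure.quasiMeasurePreserving_snd.ae hp)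

theorem law_eq_map_scalePath {a c : ℝ}
    (ha : Q'.arrivalLaw = Q.arrivalLaw.map fun x => a * x)
    (hc : Q'.serviceLaw = Q.serviceLaw.map fun x => c * x) :
    Q'.law = Q.law.map (scalePath a c) := by
  have : Q'.arrivalLaw.prod Q'.serviceLaw =
      (Q.arrivalLaw.prod Q.serviceLaw).map (fun x => (a * x.1, c * x.2)) := by
    rw [ha, hc, Measure.map_prod_map _ _ (by fun_prop) (by fun_prop)]
    rfl
  unfold law scalePath
  simp only [this]
  exact (Measure.infinitePi_map_pi (fun _ : ℕ => Q.arrivalLaw.prod Q.serviceLaw)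
    (f := fun _ x => (a * x.1, c * x.2)) (fun _ => by fun_prop)).symm

theorem loadFactor_eq (Q : InfServerQueue) :
    Q.loadFactor = (∫ t, t ∂Q.serviceLaw) / ∫ x, x ∂Q.arrivalLaw := by
  unfold loadFactor arrivalRate serviceRate
  field_simp

theorem loadFactor_pos (Q : InfServerQueue) : 0 < Q.loadFactor := by
  rw [loadFactor_eq]
  exact div_pos Q.isPdf_service.integral_lawOfPdf_pos Q.isPdf_arrival.integral_lawOfPdf_pos

theorem le_of_loadFactor_le {a c : ℝ} (ha0 : 0 < a)
    (ha : Q'.arrivalLaw = Q.arrivalLaw.map fun x => a * x)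
    (hc : Q'.serviceLaw = Q.serviceLaw.map fun x => c * x)
    (h : Q'.loadFactor ≤ Q.loadFactor) : c ≤ a := by
  have h1 : Q'.loadFactor = c / a * Q.loadFactor := by
    rw [loadFactor_eq, loadFactor_eq, ha, hc, integral_map (by fun_prop) (by fun_prop),
      integral_map (by fun_prop) (by fun_prop), integral_const_mul, integral_const_mul,
      mul_div_mul_comm]
  rw [h1] at h
  exact (div_le_one ha0).1 (le_of_mul_le_mul_right (by simpa using h) Q.loadFactor_pos)

/-! ### FIFO matching -/

/-- FIFO is correct when the first `b` departures occur in the order of the arrivals. -/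
noncomputable def fifoWeight (b : ℕ) : (ℕ → ℝ × ℝ) → ℝ≥0∞ :=
  {ω | ∀ i < b, ∀ j < b, i ≤ j → departureTime ω i ≤ departureTime ω j}.indicator 1

/-- `Tuple.sort` breaks ties by index, so it is the identity exactly when departures are
nondecreasing. Ties need no null set. -/
theorem isWeightOf_fifoWeight (Q : InfServerQueue) : Q.IsWeightOf fifoPolicy fifoWeight where
  measurable b := by
    refine measurable_one.indicator ?_
    have : {ω : ℕ → ℝ × ℝ | ∀ i < b, ∀ j < b, i ≤ j → departureTime ω i ≤ departureTime ω j} =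
        ⋂ i, ⋂ (_ : i < b), ⋂ j, ⋂ (_ : j < b), ⋂ (_ : i ≤ j),
          {ω | departureTime ω i ≤ departureTime ω j} := by
      ext ω; simp
    rw [this]
    exact .iInter fun i => .iInter fun _ => .iInter fun j => .iInter fun _ => .iInter fun _ =>
      measurableSet_le (by fun_prop) (by fun_prop)
  ae_eq := ae_of_all _ fun ω b => by
    have h : trueMatching ω b = 1 ↔
        ∀ i < b, ∀ j < b, i ≤ j → departureTime ω i ≤ departureTime ω j := by
      rw [trueMatching, inv_eq_one, Equiv.Perm.one_def, Tuple.sort_eq_refl_iff_monotone]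
      exact ⟨fun h i hi j hj hij => h (show (⟨i, hi⟩ : Fin b) ≤ ⟨j, hj⟩ from hij),
        fun h i j hij => h i i.2 j j.2 hij⟩
    rw [fifoPolicy, PMF.pure_apply, fifoWeight]
    by_cases hω : ∀ i < b, ∀ j < b, i ≤ j → departureTime ω i ≤ departureTime ω j
    · rw [if_pos (h.2 hω), Set.indicator_of_mem (by rwa [Set.mem_ofPred_eq]), Pi.one_apply]
    · rw [if_neg (mt h.1 hω), Set.indicator_of_notMem (by rwa [Set.mem_ofPred_eq])]

theorem fifoAccuracy_le {a c : ℝ} (ha0 : 0 < a) (hc0 : 0 < c) (hca : c ≤ a)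
    (hlaw : Q'.law = Q.law.map (scalePath a c)) : Q.fifoAccuracy ≤ Q'.fifoAccuracy := by
  refine Q.isWeightOf_fifoWeight.trackingAccuracy_le Q'.isWeightOf_fifoWeight
    (measurable_scalePath a c) hlaw ?_
  filter_upwards [Q.ae_service Q.isPdf_service.ae_nonneg_lawOfPdf,
    Q.ae_law_coord (Measure.quasiMeasurePreserving_fst.ae
      Q.isPdf_arrival.ae_nonneg_lawOfPdf)] with ω hT hX b hb
  obtain ⟨b', hb'b, hb'⟩ := hb.exists_scalePath ha0 hca hT
  refine ⟨b', hb', ?_⟩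
  have hY : ∀ i j, i ≤ j → arrivalTime ω i ≤ arrivalTime ω j := fun i j hij =>
    Finset.sum_le_sum_of_subset_of_nonneg (Finset.range_mono hij) fun k _ _ => hX k
  have hsub : ω ∈ {ω | ∀ i < b, ∀ j < b, i ≤ j → departureTime ω i ≤ departureTime ω j} →
      scalePath a c ω ∈
        {ω | ∀ i < b', ∀ j < b', i ≤ j → departureTime ω i ≤ departureTime ω j} := by
    rw [Set.mem_ofPred_eq, Set.mem_ofPred_eq]
    intro h i hi j hj hij
    -- With `Y`, `D` the arrival and departure times of `ω`, the new departure gap is `c * (D j - D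
    -- i) + (a - c) * (Y j - Y i)`, a sum of two nonnegative terms.
    have h1 := mul_le_mul_of_nonneg_left
      (h i (hi.trans_le hb'b) j (hj.trans_le hb'b) hij) hc0.le
    have h2 := mul_le_mul_of_nonneg_left (hY i j hij) (sub_nonneg.2 hca)
    rw [departureTime, departureTime] at h1
    rw [departureTime_scalePath, departureTime_scalePath]
    linarith
  rw [fifoWeight, fifoWeight, Set.indicator_apply, Set.indicator_apply]
  split_ifs with h1 h2
  · exact le_rfl
  · exact absurd (hsub h1) h2
  · exact zero_le
  · exact le_rfl

end InfServerQueue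

/-! ### Absolute continuity of timestamp differences -/

theorem ProbabilityTheory.IndepFun.map_add_absolutelyContinuous {Ω : Type*} [MeasurableSpace Ω]
    {μ : Measure Ω} [IsProbabilityMeasure μ] {U V : Ω → ℝ} (h : ProbabilityTheory.IndepFun U V μ)
    (hU : Measurable U) (hV : Measurable V) (hac : μ.map V ≪ volume) :
    μ.map (U + V) ≪ volume := by
  have := Measure.isProbabilityMeasure_map (μ := μ) hV.aemeasurable
  rw [h.map_add_eq_map_conv_map hU hV]
  exact Measure.conv_absolutelyContinuous hac

namespace InfServerQueue

open ProbabilityTheory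

variable {Q Q' : InfServerQueue}

theorem serviceLaw_absolutelyContinuous (Q : InfServerQueue) : Q.serviceLaw ≪ volume :=
  withDensity_absolutelyContinuous _ _

theorem map_service_add_arrival_absolutelyContinuous (Q : InfServerQueue) (c : ℝ) :
    (Q.arrivalLaw.prod Q.serviceLaw).map (fun x => x.2 + c * x.1) ≪ volume := by
  have h := (indepFun_prod (μ := Q.arrivalLaw) (ν := Q.serviceLaw) (X := fun x => c * x)
    (Y := fun x => x) (by fun_prop) (by fun_prop)).map_add_absolutelyContinuous
    (by fun_prop) (by fun_prop) (by
      have : (Q.arrivalLaw.prod Q.serviceLaw).map (fun ω => ω.2) = Q.serviceLaw :=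
        measurePreserving_snd.map_eq
      rw [this]
      exact Q.serviceLaw_absolutelyContinuous)
  convert h using 2
  funext x
  simp [add_comm]

/-- The `j`-th pair contributes a term containing its service time, which has an absolutely
continuous law whatever `c j` is. The other terms are independent of it, and convolution preserves
absolute continuity. -/
theorem map_service_add_sum_absolutelyContinuous (Q : InfServerQueue) (c : ℕ → ℝ) {M j : ℕ}
    (hj : j < M) :
    Q.law.map (fun ω => (ω j).2 + ∑ k ∈ Finset.range M, c k * (ω k).1) ≪ volume := by
  set g : ℕ → ℝ × ℝ → ℝ := fun k x => if k = j then x.2 + c k * x.1 else c k * x.1 with hg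
  have hgm : ∀ k, Measurable (g k) := fun k => by
    by_cases hk : k = j
    · simp only [hg, hk, if_true]; fun_prop
    · simp only [hg, hk, if_false]; fun_prop
  have hind := (iIndepFun_infinitePi (P := fun _ : ℕ => Q.arrivalLaw.prod Q.serviceLaw)
    hgm).indepFun_finsetSum_of_notMem (fun k => (hgm k).comp (measurable_pi_apply k))
    (Finset.notMem_erase j (Finset.range M))
  have h := hind.map_add_absolutelyContinuous (by
      refine Finset.sum_induction _ Measurable (fun _ _ => Measurable.add) measurable_zero
        fun k _ => ?_
      exact (hgm k).comp (measurable_pi_apply k))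
    ((hgm j).comp (measurable_pi_apply j)) (by
      have h1 := Measure.map_map (μ := Measure.infinitePi
        fun _ : ℕ => Q.arrivalLaw.prod Q.serviceLaw) (hgm j) (measurable_pi_apply j)
      rw [Measure.infinitePi_map_eval] at h1
      have h3 : g j = fun x => x.2 + c j * x.1 := by simp [hg]
      have h4 := Q.map_service_add_arrival_absolutelyContinuous (c j)
      rw [← h3, h1] at h4
      exact h4)
  rw [law]
  convert h using 2
  funext ω
  rw [← Finset.add_sum_erase _ _ (Finset.mem_range.2 hj), Pi.add_apply, Finset.sum_apply, add_comm]
  have h5 : ∀ k ∈ (Finset.range M).erase j, g k (ω k) = c k * (ω k).1 := fun k hk => by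
    simp [hg, Finset.ne_of_mem_erase hk]
  rw [Finset.sum_congr rfl h5]
  simp only [hg, if_true]
  ring

theorem arrivalTime_eq_sum_ite (ω : ℕ → ℝ × ℝ) {i M : ℕ} (hi : i ≤ M) :
    arrivalTime ω i = ∑ k ∈ Finset.range M, (if k < i then 1 else 0) * (ω k).1 := by
  simp only [ite_mul, one_mul, zero_mul, ← Finset.sum_filter]
  rw [arrivalTime]
  congr 1
  ext k
  simp only [Finset.mem_range, Finset.mem_filter]
  omega

/-- Differences of timestamps involving a service time avoid null sets. -/
theorem ae_service_add_arrivalTime_sub (Q : InfServerQueue) {p : ℝ → Prop}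
    (hp : ∀ᵐ t, p t) (s : ℝ) :
    ∀ᵐ ω ∂Q.law, ∀ i j, p ((ω j).2 + s * (arrivalTime ω j - arrivalTime ω i)) := by
  refine ae_all_iff.2 fun i => ae_all_iff.2 fun j => ?_
  have h := (Q.map_service_add_sum_absolutelyContinuous
    (fun k => s * ((if k < j then 1 else 0) - (if k < i then 1 else 0)))
    (show j < i + j + 1 by omega)).ae_le hp
  have h1 := ae_of_ae_map (by fun_prop) h
  filter_upwards [h1] with ω hω
  convert hω using 2
  rw [arrivalTime_eq_sum_ite ω (show j ≤ i + j + 1 by omega),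
    arrivalTime_eq_sum_ite ω (show i ≤ i + j + 1 by omega), ← Finset.sum_sub_distrib,
    Finset.mul_sum]
  exact Finset.sum_congr rfl fun k _ => by ring

theorem ae_servicePdf_pos_imp {c : ℝ}
    (hc : Q'.serviceLaw = Q.serviceLaw.map fun x => c * x) :
    ∀ᵐ t, 0 < Q.servicePdf t → 0 < Q'.servicePdf (c * t) := by
  have h : ∀ᵐ t ∂Q'.serviceLaw, 0 < Q'.servicePdf t := Q'.isPdf_service.ae_pos_lawOfPdf
  rw [hc] at h
  have h1 := ae_of_ae_map (by fun_prop) h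
  rw [serviceLaw, lawOfPdf, ae_withDensity_iff Q.isPdf_service.measurable.ennreal_ofReal] at h1
  filter_upwards [h1] with t ht h0
  exact ht (by simpa using h0)

/-- Only the laws are related by rescaling, so the densities can be compared only almost everywhere;
each implication uses one direction of the rescaling. -/
theorem ae_servicePdf_pos_iff {c : ℝ} (hc0 : 0 < c)
    (hc : Q'.serviceLaw = Q.serviceLaw.map fun x => c * x) :
    ∀ᵐ t, 0 < Q'.servicePdf (c * t) ↔ 0 < Q.servicePdf t := by
  have hinv : Q.serviceLaw = Q'.serviceLaw.map fun x => c⁻¹ * x := by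
    rw [hc, Measure.map_map (by fun_prop) (by fun_prop)]
    have : (fun x : ℝ => c⁻¹ * x) ∘ (fun x => c * x) = id := by
      funext x
      simp [inv_mul_cancel_left₀ hc0.ne']
    rw [this, Measure.map_id]
  have hq : Measure.QuasiMeasurePreserving (fun x : ℝ => c * x) volume volume := by
    refine ⟨by fun_prop, ?_⟩
    rw [Real.map_volume_mul_left hc0.ne']
    exact Measure.smul_absolutelyContinuous
  filter_upwards [ae_servicePdf_pos_imp hc, hq.ae (ae_servicePdf_pos_imp hinv)] with t h1 h2
  refine ⟨fun h => ?_, h1⟩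
  have := h2 h
  rwa [inv_mul_cancel_left₀ hc0.ne'] at this

end InfServerQueue

/-! ### Random matching and the count of rearrangements -/

open Classical in
/-- The rearrangements of the true matching that have positive likelihood. -/
noncomputable def rearrangements (f : ℝ → ℝ) (ω : ℕ → ℝ × ℝ) (b : ℕ) :
    Finset (Equiv.Perm (Fin b)) :=
  Finset.univ.filter fun σ => ∀ i, 0 < f (departureTime ω (σ i) - arrivalTime ω i)

theorem mem_rearrangements {f : ℝ → ℝ} {ω : ℕ → ℝ × ℝ} {b : ℕ} {σ : Equiv.Perm (Fin b)} :
    σ ∈ rearrangements f ω b ↔ ∀ i, 0 < f (departureTime ω (σ i) - arrivalTime ω i) := by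
  simp [rearrangements]

theorem measurable_card_rearrangements {f : ℝ → ℝ} (hf : Measurable f) (b : ℕ) :
    Measurable fun ω => ((rearrangements f ω b).card : ℝ≥0∞) := by
  classical
  have : (fun ω => ((rearrangements f ω b).card : ℝ≥0∞)) = fun ω => ∑ σ : Equiv.Perm (Fin b),
      {ω | ∀ i, 0 < f (departureTime ω (σ i) - arrivalTime ω i)}.indicator 1 ω := by
    funext ω
    rw [rearrangements, Finset.card_filter, Nat.cast_sum]
    refine Finset.sum_congr rfl fun σ _ => ?_
    rw [Set.indicator_apply, Nat.cast_ite, Nat.cast_one, Nat.cast_zero]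
    simp only [Set.mem_ofPred_eq, Pi.one_apply]
  rw [this]
  refine Finset.measurable_sum _ fun σ _ => measurable_one.indicator ?_
  have : {ω : ℕ → ℝ × ℝ | ∀ i, 0 < f (departureTime ω (σ i) - arrivalTime ω i)} =
      ⋂ i, {ω | 0 < f (departureTime ω (σ i) - arrivalTime ω i)} := by ext; simp
  rw [this]
  exact .iInter fun i => measurableSet_lt (by fun_prop) (by fun_prop)

theorem mem_validMatchings {f : ℝ → ℝ} (hf : ∀ t, 0 ≤ f t) {b : ℕ} {y d : Fin b → ℝ}
    {π : Equiv.Perm (Fin b)} : π ∈ validMatchings f y d ↔ ∀ i, 0 < f (d (π i) - y i) := by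
  rw [validMatchings, Finset.mem_filter, and_iff_right (Finset.mem_univ _)]
  refine ⟨fun h i => (hf _).lt_of_ne' fun h0 => h.ne' ?_, fun h => Finset.prod_pos fun i _ => h i⟩
  exact Finset.prod_eq_zero (Finset.mem_univ i) h0

/-- Multiplying by the true matching undoes the sorting of departures, so valid matchings can be
counted with departures indexed by transaction. -/
theorem trueMatching_mul_mem_validMatchings {f : ℝ → ℝ} (hf : ∀ t, 0 ≤ f t) {ω : ℕ → ℝ × ℝ}
    {b : ℕ} {σ : Equiv.Perm (Fin b)} :
    trueMatching ω b * σ ∈ validMatchings f (arrivalStamps ω b) (departureStamps ω b) ↔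
      σ ∈ rearrangements f ω b := by
  simp [mem_validMatchings hf, mem_rearrangements, departureStamps, arrivalStamps, trueMatching]

theorem card_validMatchings {f : ℝ → ℝ} (hf : ∀ t, 0 ≤ f t) (ω : ℕ → ℝ × ℝ) (b : ℕ) :
    (validMatchings f (arrivalStamps ω b) (departureStamps ω b)).card =
      (rearrangements f ω b).card :=
  (Finset.card_equiv (Equiv.mulLeft (trueMatching ω b)) fun _ =>
    (trueMatching_mul_mem_validMatchings hf).symm).symm

theorem randomPolicy_trueMatching {f : ℝ → ℝ} (hf : ∀ t, 0 ≤ f t) {ω : ℕ → ℝ × ℝ}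
    (hω : ∀ i, 0 < f (ω i).2) (b : ℕ) :
    randomPolicy f b (arrivalStamps ω b) (departureStamps ω b) (trueMatching ω b) =
      ((rearrangements f ω b).card : ℝ≥0∞)⁻¹ := by
  have h : trueMatching ω b ∈ validMatchings f (arrivalStamps ω b) (departureStamps ω b) := by
    rw [← mul_one (trueMatching ω b), trueMatching_mul_mem_validMatchings hf, mem_rearrangements]
    intro i
    simpa [departureTime] using hω i
  have hne : (validMatchings f (arrivalStamps ω b) (departureStamps ω b)).Nonempty := ⟨_, h⟩
  rw [randomPolicy, dif_pos hne, PMF.uniformOfFinset_apply_of_mem _ h, card_validMatchings hf]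

/-- Shrinking service times relative to inter-arrival times, and the busy period with them, loses
rearrangements when the service density is supported on an interval. -/
theorem card_rearrangements_scalePath_le {f f' : ℝ → ℝ} {I : Set ℝ} (hI : I.OrdConnected)
    {a c : ℝ} (hc0 : 0 < c) (hca : c ≤ a) {ω : ℕ → ℝ × ℝ} (hω : ∀ i, 0 < f (ω i).2)
    (hf : ∀ i j, 0 < f (departureTime ω j - arrivalTime ω i) ↔
      departureTime ω j - arrivalTime ω i ∈ I)
    (hf' : ∀ i j, 0 < f' (departureTime (scalePath a c ω) j - arrivalTime (scalePath a c ω) i) ↔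
      (ω j).2 + a / c * (arrivalTime ω j - arrivalTime ω i) ∈ I)
    {b b' : ℕ} (hb : b' ≤ b) :
    (rearrangements f' (scalePath a c ω) b').card ≤ (rearrangements f ω b).card := by
  classical
  have hTI : ∀ i, (ω i).2 ∈ I := fun i => by
    have := hf i i
    rw [departureTime, add_sub_cancel_left] at this
    exact this.1 (hω i)
  have hr : 1 ≤ a / c := (one_le_div hc0).2 hca
  have hpos : ∀ i j, 0 < f' (departureTime (scalePath a c ω) j -
      arrivalTime (scalePath a c ω) i) → 0 < f (departureTime ω j - arrivalTime ω i) := by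
    intro i j h
    rw [hf]
    have h1 := (hf' i j).1 h
    have h2 : departureTime ω j - arrivalTime ω i =
        (ω j).2 + (arrivalTime ω j - arrivalTime ω i) := by rw [departureTime]; ring
    rw [h2]
    -- Since `a / c ≥ 1`, the original difference lies between the service time of `j` and the
    -- rescaled difference divided by `c`. Both are in `I`; the sign of the arrival gap decides
    -- which is the left endpoint.
    rcases le_total 0 (arrivalTime ω j - arrivalTime ω i) with h3 | h3
    · exact hI.out (hTI j) h1 ⟨by linarith, by nlinarith⟩
    · exact hI.out h1 (hTI j) ⟨by nlinarith, by linarith⟩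
  -- A rearrangement of the shorter busy period is extended by the identity. Each added transaction
  -- keeps its own service time, where `f` is positive.
  refine Finset.card_le_card_of_injOn
    (fun σ => σ.viaFintypeEmbedding (Fin.castLEEmb hb)) (fun σ hσ => ?_) ?_
  · rw [Finset.mem_coe, mem_rearrangements] at hσ ⊢
    intro i
    by_cases hi : (i : ℕ) < b'
    · have h1 := Equiv.Perm.viaFintypeEmbedding_apply_image σ (Fin.castLEEmb hb) ⟨i, hi⟩
      have h2 : (Fin.castLEEmb hb) ⟨i, hi⟩ = i := by ext; simp
      rw [h2] at h1
      rw [h1]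
      exact hpos _ _ (hσ ⟨i, hi⟩)
    · rw [Equiv.Perm.viaFintypeEmbedding_apply_notMem_range]
      · simpa [departureTime] using hω i
      · rintro ⟨k, rfl⟩
        exact hi (by simp)
  · intro σ _ τ _ h
    ext i
    have h1 := DFunLike.congr_fun h ((Fin.castLEEmb hb) i)
    simp only [Equiv.Perm.viaFintypeEmbedding_apply_image] at h1
    simpa using congrArg Fin.val h1

namespace InfServerQueue

variable {Q Q' : InfServerQueue}

theorem isWeightOf_randomPolicy (Q : InfServerQueue) :
    Q.IsWeightOf (randomPolicy Q.servicePdf)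
      fun b ω => ((rearrangements Q.servicePdf ω b).card : ℝ≥0∞)⁻¹ where
  measurable b := (measurable_card_rearrangements Q.isPdf_service.measurable b).inv
  ae_eq := by
    filter_upwards [Q.ae_service Q.isPdf_service.ae_pos_lawOfPdf] with ω hω b
    exact randomPolicy_trueMatching Q.isPdf_service.nonneg hω b

theorem randomAccuracy_le (hI : HasIntervalSupport Q.servicePdf) {a c : ℝ} (ha0 : 0 < a)
    (hc0 : 0 < c) (hca : c ≤ a) (hc : Q'.serviceLaw = Q.serviceLaw.map fun x => c * x)
    (hlaw : Q'.law = Q.law.map (scalePath a c)) : Q.randomAccuracy ≤ Q'.randomAccuracy := by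
  obtain ⟨I, hI, hfI⟩ := hI
  have hfI' : ∀ᵐ t, 0 < Q.servicePdf t ↔ t ∈ I := by
    filter_upwards [hfI.mem_iff] with t ht using ht
  have hf'I : ∀ᵐ t, 0 < Q'.servicePdf (c * t) ↔ t ∈ I := by
    filter_upwards [hfI', ae_servicePdf_pos_iff hc0 hc] with t h1 h2 using h2.trans h1
  refine Q.isWeightOf_randomPolicy.trackingAccuracy_le Q'.isWeightOf_randomPolicy
    (measurable_scalePath a c) hlaw ?_
  filter_upwards [Q.ae_service Q.isPdf_service.ae_nonneg_lawOfPdf,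
    Q.ae_service Q.isPdf_service.ae_pos_lawOfPdf, Q.ae_service_add_arrivalTime_sub hfI' 1,
    Q.ae_service_add_arrivalTime_sub hf'I (a / c)] with ω hT hfT h1 h2 b hb
  obtain ⟨b', hb'b, hb'⟩ := hb.exists_scalePath ha0 hca hT
  refine ⟨b', hb', ENNReal.inv_le_inv.2 (Nat.cast_le.2
    (card_rearrangements_scalePath_le hI hc0 hca hfT (fun i j => ?_) (fun i j => ?_) hb'b))⟩
  · have h : departureTime ω j - arrivalTime ω i =
        (ω j).2 + 1 * (arrivalTime ω j - arrivalTime ω i) := by rw [departureTime]; ring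
    rw [h]
    exact h1 i j
  · rw [← h2 i j, departureTime_scalePath, arrivalTime_scalePath]
    -- Factoring out `c` reduces the rescaled density to the original support, which explains the
    -- slope `a / c`.
    have h : a * arrivalTime ω j + c * (ω j).2 - a * arrivalTime ω i =
        c * ((ω j).2 + a / c * (arrivalTime ω j - arrivalTime ω i)) := by
      field_simp
      ring
    rw [h]

/-- Queues from common families are coupled by a rescaling of paths. -/
theorem exists_rescaling {νX νT : Measure ℝ} (hX : IsLinearRescaling Q.arrivalLaw νX)
    (hX' : IsLinearRescaling Q'.arrivalLaw νX) (hT : IsLinearRescaling Q.serviceLaw νT)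
    (hT' : IsLinearRescaling Q'.serviceLaw νT) (h : Q'.loadFactor ≤ Q.loadFactor) :
    ∃ a c : ℝ, 0 < a ∧ 0 < c ∧ c ≤ a ∧ Q'.serviceLaw = Q.serviceLaw.map (fun x => c * x) ∧
      Q'.law = Q.law.map (scalePath a c) := by
  obtain ⟨a, ha0, ha⟩ := hX.exists_map_eq hX'
  obtain ⟨c, hc0, hc⟩ := hT.exists_map_eq hT'
  exact ⟨a, c, ha0, hc0, le_of_loadFactor_le ha0 ha hc h, hc, law_eq_map_scalePath ha hc⟩

end InfServerQueue

theorem mainTheorem7 {ι : Type*} [Fintype ι] (Q : ι → InfServerQueue) (νX νT : Measure ℝ)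
    (hX : ∀ k, IsLinearRescaling (Q k).arrivalLaw νX)
    (hT : ∀ k, IsLinearRescaling (Q k).serviceLaw νT) :
    ((∀ k m, (Q m).loadFactor ≤ (Q k).loadFactor → (Q k).fifoAccuracy ≤ (Q m).fifoAccuracy) ∧
      ∀ (E : ℕ) (z : ι → ℝ), IsLoadFactorAllocation (fun k => (Q k).loadFactor) E z →
        IsOptimalAllocation (fun k => (Q k).fifoAccuracy) E z) ∧
    ((∀ k, HasIntervalSupport (Q k).servicePdf) →
      (∀ k m, (Q m).loadFactor ≤ (Q k).loadFactor →
        (Q k).randomAccuracy ≤ (Q m).randomAccuracy) ∧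
      ∀ (E : ℕ) (z : ι → ℝ), IsLoadFactorAllocation (fun k => (Q k).loadFactor) E z →
        IsOptimalAllocation (fun k => (Q k).randomAccuracy) E z) := by

  have hfifo : ∀ k m, (Q m).loadFactor ≤ (Q k).loadFactor →
      (Q k).fifoAccuracy ≤ (Q m).fifoAccuracy := fun k m h => by
    obtain ⟨a, c, ha0, hc0, hca, -, hlaw⟩ :=
      InfServerQueue.exists_rescaling (hX k) (hX m) (hT k) (hT m) h
    exact InfServerQueue.fifoAccuracy_le ha0 hc0 hca hlaw
  refine ⟨⟨hfifo, fun E z hz => hz.isOptimalAllocation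
    (fun k => (Q k).isWeightOf_fifoWeight.trackingAccuracy_le_one) hfifo⟩, fun hI => ?_⟩
  have hrand : ∀ k m, (Q m).loadFactor ≤ (Q k).loadFactor →
      (Q k).randomAccuracy ≤ (Q m).randomAccuracy := fun k m h => by
    obtain ⟨a, c, ha0, hc0, hca, hc, hlaw⟩ :=
      InfServerQueue.exists_rescaling (hX k) (hX m) (hT k) (hT m) h
    exact InfServerQueue.randomAccuracy_le (hI k) ha0 hc0 hca hc hlaw
  exact ⟨hrand, fun E z hz => hz.isOptimalAllocation
    (fun k => (Q k).isWeightOf_randomPolicy.trackingAccuracy_le_one) hrand⟩
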